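/- Let $U:\mathbb R\to\mathbb R$ be a smooth skew periodic potential, i.e. $U(x)=\tilde U(x)-\bar b x$ with $\tilde U$ smooth and $1$-periodic and $\bar b\in\mathbb R$. Assume that, for some $k\ge 1$, the critical points of $U$ are exactly the points $x_i, x_{i+\frac12}$, $i\in\mathbb Z$, where $x_i<x_{i+\frac12}<x_{i+1}$, $x_{i+k}=x_i+1$, $x_{i+k+\frac12}=x_{i+\frac12}+1$, each $x_i$ is a local minimum and each $x_{i+\frac12}$ a local maximum of $U$. Let $\mathbb S^1=\mathbb R/\mathbb Z$, let $H(p,x)=p(p-U'(x))$ and let $L(s,x)=\sup_p(sp-H(p,x))=\frac14(s+U'(x))^2$ be the associated Lagrangian. For $x,y\in\mathbb S^1$ and $T\ge0$ put $$A_T(y;x)=\inf_{\gamma(0)=x,\ \gamma(T)=y}\int_0^T L(\dot\gamma,\gamma)\,dt\in[0,\infty]$$ (infimum over absolutely continuous curves $\gamma:[0,T]\to\mathbb S^1$), and define the Mañé potential $v(y;x)=\inf_{T\ge 0}A_T(y;x)$, the Peierls barrier $h(y;x)=\liminf_{T\to+\infty}A_T(y;x)$, the projected Aubry set $\mathcal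 A=\{x\in\mathbb S^1: h(x;x)=0\}$, and the Lax--Oleinik semigroup $(S_tu)(y)=\inf_{x\in\mathbb S^1}\{u(x)+A_t(y;x)\}$, $t\ge0$. A weak KAM solution (of negative type) of $H(w'(x),x)=0$ on $\mathbb S^1$ is a function $w\in C(\mathbb S^1)$ such that (I) $w(\gamma(b))-w(\gamma(a))\le\int_a^bL(\dot\gamma,\gamma)\,dt$ for every absolutely continuous curve $\gamma:[a,b]\to\mathbb S^1$, and (II) for every $x\in\mathbb S^1$ there is a continuous, piecewise $C^1$ curve $\gamma:(-\infty,0]\to\mathbb S^1$ with $\gamma(0)=x$ and $w(\gamma(b))-w(\gamma(a))=\int_a^bL(\dot\gamma,\gamma)\,dt$ for all $a<b\le0$. Then $\mathcal A$ is the set of (the classes in $\mathbb S^1$ of) the critical points $x_i, x_{i+\frac12}$ of $U$, and every weak KAM solution $w$ satisfies $S_tw=w$ for all $t\ge0$ and $$w(y)=\inf_{x\in\mathbb S^1}\{w(x)+v(y;x)\}=\inf_{x\in\mathcal A}\{w(x)+h(y;x)\}\qquad\text{for all }y\in\mathbb S^1 .$$ In particular, let $W$ be the Freidlin--Wentzell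 function, defined as follows. For $p,q\in\mathbb R$ let $B(q;p)$ be the infimum of $\int_0^TL(\dot\gamma,\gamma)\,dt$ over all $T\ge0$ and all absolutely continuous curves $\gamma:[0,T]\to\mathbb R$ with $\gamma(0)=p$, $\gamma(T)=q$. For $1\le i,j\le k$ let $\tilde h_R(x_i;x_{j+1})$ be $B(x_i;x_{j+1})$ if $j<i$ and $B(x_{i+k};x_{j+1})$ if $j\ge i$, and let $\tilde h_L(x_i;x_j)$ be $B(x_i;x_j)$ if $j\ge i$ and $B(x_{i-k};x_j)$ if $j<i$. Put $$W_i=\min_{1\le j\le k}\bigl(\tilde h_R(x_i;x_{j+1})+\tilde h_L(x_i;x_j)\bigr),\qquad W(y)=\min_{1\le j\le k}\bigl(W_j+h(y;x_j)\bigr),\quad y\in\mathbb S^1 .$$ Then $W$ is finite on $\mathbb S^1$ and $S_tW=W$ for all $t\ge0$. -/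

import Mathlib

open Set Filter MeasureTheory
open scoped ENNReal ContDiff

noncomputable section

/-- A smooth skew periodic potential: `U = V - b x` with `V` smooth and `1`-periodic. -/
def IsSkewPeriodicPotential (U : ℝ → ℝ) : Prop :=
  ContDiff ℝ ∞ U ∧ ∃ (V : ℝ → ℝ) (b : ℝ),
    ContDiff ℝ ∞ V ∧ Function.Periodic V 1 ∧ ∀ p, U p = V p - b * p

/-- The critical points of `U` are listed as follows: there are `k ≥ 1` local minima
`x 1, …, x k` in each period, interleaved by `k` local maxima `z 1, …, z k`
(`z i` stands for `x_{i+1/2}`), both families being extended to all integer indices by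
`x (i + k) = x i + 1` and `z (i + k) = z i + 1`; there are no other critical points. -/
structure HasInterleavedCriticalPoints (U : ℝ → ℝ) (k : ℕ) (x z : ℤ → ℝ) : Prop where
  pos : 0 < k
  x_add : ∀ i, x (i + k) = x i + 1
  z_add : ∀ i, z (i + k) = z i + 1
  x_lt_z : ∀ i, x i < z i
  z_lt_x : ∀ i, z i < x (i + 1)
  isLocalMin : ∀ i, IsLocalMin U (x i)
  isLocalMax : ∀ i, IsLocalMax U (z i)
  critical_iff : ∀ p, deriv U p = 0 ↔ (∃ i, p = x i) ∨ (∃ i, p = z i)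

/-- The Hamiltonian `H(p, q) = p (p - U'(q))`. -/
def hamiltonian (U : ℝ → ℝ) (p q : ℝ) : ℝ := p * (p - deriv U q)

/-- The Lagrangian `L(s, q) = (s + U'(q))² / 4`. For a skew periodic `U` it is `1`-periodic
in `q`, so it is a Lagrangian on the circle `ℝ / ℤ`. -/
def lagrangian (U : ℝ → ℝ) (s q : ℝ) : ℝ := (s + deriv U q) ^ 2 / 4

/-- `L` is the convex conjugate of `H`. -/
theorem isLUB_lagrangian (U : ℝ → ℝ) (s q : ℝ) :
    IsLUB (range fun p => s * p - hamiltonian U p q) (lagrangian U s q) := by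
  constructor
  · rintro _ ⟨p, rfl⟩
    simp only [hamiltonian, lagrangian]
    nlinarith [sq_nonneg (s + deriv U q - 2 * p)]
  · intro c hc
    have h := hc ⟨(s + deriv U q) / 2, rfl⟩
    simp only [hamiltonian] at h
    simp only [lagrangian]
    linarith

/-- The action `∫_a^b L(γ'(t), γ(t)) dt ∈ [0, ∞]` of a curve `γ`. Curves on the circle are
given by their lifts to `ℝ`: the absolutely continuous (resp. piecewise `C¹`) curves on the
circle are exactly the projections `t ↦ (γ t : UnitAddCircle)` of absolutely continuous
(resp. piecewise `C¹`) curves `γ` on `ℝ`, and have the same velocity and the same action. -/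
def action (U : ℝ → ℝ) (γ : ℝ → ℝ) (a b : ℝ) : ℝ≥0∞ :=
  ∫⁻ t in Icc a b, ENNReal.ofReal (lagrangian U (deriv γ t) (γ t))

/-- The least action, in time exactly `T`, of curves on the circle from `x` to `y`. -/
def leastAction (U : ℝ → ℝ) (T : ℝ) (y x : UnitAddCircle) : ℝ≥0∞ :=
  ⨅ (γ : ℝ → ℝ) (_ : AbsolutelyContinuousOnInterval γ 0 T)
    (_ : (γ 0 : UnitAddCircle) = x) (_ : (γ T : UnitAddCircle) = y), action U γ 0 T

/-- The Mañé potential `v(y; x)` on the circle (the critical value is `0`). -/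
def manePotential (U : ℝ → ℝ) (y x : UnitAddCircle) : ℝ≥0∞ :=
  ⨅ (T : ℝ) (_ : 0 ≤ T), leastAction U T y x

/-- The Peierls barrier `h(y; x)` on the circle. -/
def peierlsBarrier (U : ℝ → ℝ) (y x : UnitAddCircle) : ℝ≥0∞ :=
  liminf (fun T : ℝ => leastAction U T y x) atTop

/-- The projected Aubry set `{x | h(x; x) = 0}`. -/
def projectedAubrySet (U : ℝ → ℝ) : Set UnitAddCircle :=
  {x | peierlsBarrier U x x = 0}

/-- The Lax–Oleinik semigroup,
`(S_t u)(y) = inf_x (u(x) + inf_{γ(0) = x, γ(t) = y} ∫_0^t L(γ', γ))`. -/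
def laxOleinik (U : ℝ → ℝ) (t : ℝ) (u : UnitAddCircle → EReal) (y : UnitAddCircle) : EReal :=
  ⨅ x : UnitAddCircle, u x + (leastAction U t y x : EReal)

/-- `γ` is continuous and piecewise `C¹` on `(-∞, 0]`: every `[a, 0]` splits into finitely many
closed intervals on each of which `γ` is `C¹` up to the end points. -/
def IsPiecewiseC1OnIic (γ : ℝ → ℝ) : Prop :=
  ContinuousOn γ (Iic 0) ∧ ∀ a < 0, ∃ (n : ℕ) (τ : ℕ → ℝ), τ 0 = a ∧ τ n = 0 ∧
    ∀ i < n, τ i < τ (i + 1) ∧ ContDiffOn ℝ 1 γ (Icc (τ i) (τ (i + 1)))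

/-- Weak KAM solutions (of negative type) of `H(w'(x), x) = 0` on the circle. -/
structure IsWeakKAMSolution (U : ℝ → ℝ) (w : UnitAddCircle → ℝ) : Prop where
  continuous : Continuous w
  dominated : ∀ (γ : ℝ → ℝ) (a b : ℝ), a ≤ b → AbsolutelyContinuousOnInterval γ a b →
    ((w (γ b) - w (γ a) : ℝ) : EReal) ≤ (action U γ a b : EReal)
  calibrated : ∀ x : UnitAddCircle, ∃ γ : ℝ → ℝ, (γ 0 : UnitAddCircle) = x ∧
    IsPiecewiseC1OnIic γ ∧ ∀ a b : ℝ, a < b → b ≤ 0 →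
      ((w (γ b) - w (γ a) : ℝ) : EReal) = (action U γ a b : EReal)

/-- The least action of curves on the real line (the universal cover of the circle) from `p`
to `q`, over all times. For `q ≥ p` this is the right barrier `h_R(q; p)`, for `q ≤ p` it is
the left barrier `h_L(q; p)`. -/
def lineBarrier (U : ℝ → ℝ) (q p : ℝ) : ℝ≥0∞ :=
  ⨅ (T : ℝ) (_ : 0 ≤ T) (γ : ℝ → ℝ) (_ : AbsolutelyContinuousOnInterval γ 0 T)
    (_ : γ 0 = p) (_ : γ T = q), action U γ 0 T

/-- The cost `h̃_R(x_i; x_{j+1})` of the counterclockwise path from `x_{j+1}` to `x_i`,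
`1 ≤ i, j ≤ k`. -/
def costRight (U : ℝ → ℝ) (k : ℕ) (x : ℤ → ℝ) (i j : ℤ) : ℝ≥0∞ :=
  if j < i then lineBarrier U (x i) (x (j + 1)) else lineBarrier U (x (i + k)) (x (j + 1))

/-- The cost `h̃_L(x_i; x_j)` of the clockwise path from `x_j` to `x_i`, `1 ≤ i, j ≤ k`. -/
def costLeft (U : ℝ → ℝ) (k : ℕ) (x : ℤ → ℝ) (i j : ℤ) : ℝ≥0∞ :=
  if i ≤ j then lineBarrier U (x i) (x j) else lineBarrier U (x (i - k)) (x j)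

/-- The Freidlin–Wentzell boundary values
`W_i = min_{1 ≤ j ≤ k} (h̃_R(x_i; x_{j+1}) + h̃_L(x_i; x_j))`. -/
def boundaryValue (U : ℝ → ℝ) (k : ℕ) (x : ℤ → ℝ) (i : ℤ) : ℝ≥0∞ :=
  ⨅ j ∈ Icc (1 : ℤ) k, (costRight U k x i j + costLeft U k x i j)

/-- The Freidlin–Wentzell function `W(y) = min_{1 ≤ j ≤ k} (W_j + h(y; x_j))`. -/
def freidlinWentzell (U : ℝ → ℝ) (k : ℕ) (x : ℤ → ℝ) (y : UnitAddCircle) : ℝ≥0∞ :=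
  ⨅ j ∈ Icc (1 : ℤ) k, (boundaryValue U k x j + peierlsBarrier U y (x j : UnitAddCircle))

end

/-!
Young's inequality `s p ≤ L(s, q) + H(p, q)` bounds the action of a curve from below by the
increment along it of any `C¹` subsolution of `H(φ', ·) ≤ 0`. The function
`φ' = s max(U', 0) - (1 - s) max(-U', 0)` gives `H(φ', ·) = -s (1 - s) U'² ≤ 0`, and some
`s ∈ (0, 1)` makes `φ` periodic. As `φ` is strict off the critical points of `U`, a loop based at a
noncritical point costs a fixed positive amount: either it stays near its base point for a while,
or it escapes quickly. Conversely, waiting at a critical point `c` is free. Hence the Aubry set is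
the critical set, and `h(·; c)` is the infimum over all times of the least action from `c`, which
makes it, and every infimum of translates of such functions, invariant under the Lax–Oleinik
semigroup.

For a weak KAM solution one inequality in each representation is domination. The other is attained
along a backward calibrated curve, and for the Aubry set at any limit point of that curve as time
tends to `-∞`.
-/

section AbsoluteContinuity

theorem absolutelyContinuousOnInterval_comp_monotone {X : Type*} [PseudoMetricSpace X]
    {f : ℝ → X} {g : ℝ → ℝ} {K : NNReal} {a b c d : ℝ}
    (hf : AbsolutelyContinuousOnInterval f c d) (hg : Monotone g) (hlip : LipschitzWith K g)
    (hmaps : MapsTo g (uIcc a b) (uIcc c d)) :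
    AbsolutelyContinuousOnInterval (fun t => f (g t)) a b := by
  rw [absolutelyContinuousOnInterval_iff] at hf ⊢
  intro ε hε
  obtain ⟨δ, hδ, H⟩ := hf ε hε
  refine ⟨δ / (K + 1), by positivity, fun E hE hlen =>
    H (E.1, fun i => (g (E.2 i).1, g (E.2 i).2)) ⟨?_, ?_⟩ ?_⟩
  · exact fun i hi => ⟨hmaps (hE.1 i hi).1, hmaps (hE.1 i hi).2⟩
  · intro i hi j hj hij
    have hdisj := hE.2 hi hj hij
    simp only [Function.onFun, uIoc, Set.Ioc_disjoint_Ioc, ← hg.map_max, ← hg.map_min] at hdisj ⊢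
    exact hg hdisj
  · calc ∑ i ∈ Finset.range E.1, dist (g (E.2 i).1) (g (E.2 i).2)
        ≤ ∑ i ∈ Finset.range E.1, (K + 1) * dist (E.2 i).1 (E.2 i).2 := by
          refine Finset.sum_le_sum fun i _ => (hlip.dist_le_mul _ _).trans ?_
          gcongr
          linarith
      _ = (K + 1) * ∑ i ∈ Finset.range E.1, dist (E.2 i).1 (E.2 i).2 := by rw [Finset.mul_sum]
      _ < δ := (lt_div_iff₀' (by positivity)).1 hlen

theorem absolutelyContinuousOnInterval_comp_add_const {X : Type*} [PseudoMetricSpace X]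
    {f : ℝ → X} {a b c : ℝ} (hf : AbsolutelyContinuousOnInterval f (a + c) (b + c)) :
    AbsolutelyContinuousOnInterval (fun t => f (t + c)) a b := by
  refine absolutelyContinuousOnInterval_comp_monotone hf (fun s t h => by gcongr)
    (LipschitzWith.of_dist_le_mul (K := 1) fun s t => by simp) fun t ht => ?_
  rw [← image_add_const_uIcc]
  exact mem_image_of_mem _ ht

theorem absolutelyContinuousOnInterval_comp_of_lipschitzOnWith {X Y : Type*} [PseudoMetricSpace X]
    [PseudoMetricSpace Y] {φ : X → Y} {f : ℝ → X} {s : Set X} {K : NNReal} {a b : ℝ}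
    (hφ : LipschitzOnWith K φ s) (hf : AbsolutelyContinuousOnInterval f a b)
    (hmaps : MapsTo f (uIcc a b) s) :
    AbsolutelyContinuousOnInterval (fun t => φ (f t)) a b := by
  refine squeeze_zero' (Eventually.of_forall fun E => Finset.sum_nonneg fun _ _ => dist_nonneg) ?_
    (by simpa using Tendsto.const_mul (K : ℝ) hf)
  filter_upwards [mem_inf_of_right (mem_principal_self _)] with E hE
  rw [Finset.mul_sum]
  exact Finset.sum_le_sum fun i hi =>
    hφ.dist_le_mul _ (hmaps (hE.1 i hi).1) _ (hmaps (hE.1 i hi).2)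

theorem absolutelyContinuousOnInterval_comp_of_contDiff {φ γ : ℝ → ℝ} {a b : ℝ}
    (hφ : ContDiff ℝ 1 φ) (hγ : AbsolutelyContinuousOnInterval γ a b) :
    AbsolutelyContinuousOnInterval (fun t => φ (γ t)) a b := by
  obtain ⟨K, hK⟩ := hφ.contDiffOn.exists_lipschitzOnWith (by decide) (convex_uIcc _ _)
    isCompact_uIcc
  exact absolutelyContinuousOnInterval_comp_of_lipschitzOnWith hK hγ fun t ht =>
    hγ.continuousOn.image_uIcc ▸ mem_image_of_mem γ ht

theorem absolutelyContinuousOnInterval_const {X : Type*} [PseudoMetricSpace X] (c : X) (a b : ℝ) :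
    AbsolutelyContinuousOnInterval (fun _ : ℝ => c) a b :=
  (LipschitzWith.const c).lipschitzOnWith.absolutelyContinuousOnInterval

theorem exists_absolutelyContinuousOnInterval_concat {F : Type*} [SeminormedAddCommGroup F]
    {f g : ℝ → F} {a b c : ℝ} (hab : a ≤ b) (hbc : b ≤ c)
    (hf : AbsolutelyContinuousOnInterval f a b) (hg : AbsolutelyContinuousOnInterval g b c)
    (hfg : f b = g b) :
    ∃ h : ℝ → F, AbsolutelyContinuousOnInterval h a c ∧ EqOn h f (Iic b) ∧ EqOn h g (Ici b) := by
  have hleft : AbsolutelyContinuousOnInterval (fun t => f (min t b)) a c := by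
    refine absolutelyContinuousOnInterval_comp_monotone hf (fun s t h => min_le_min_right b h)
      (LipschitzWith.id.min_const b) fun t ht => ?_
    rw [uIcc_of_le (hab.trans hbc)] at ht
    rw [uIcc_of_le hab]
    exact ⟨le_min ht.1 hab, min_le_right _ _⟩
  have hright : AbsolutelyContinuousOnInterval (fun t => g (max t b)) a c := by
    refine absolutelyContinuousOnInterval_comp_monotone hg (fun s t h => max_le_max_right b h)
      (LipschitzWith.id.max_const b) fun t ht => ?_
    rw [uIcc_of_le (hab.trans hbc)] at ht
    rw [uIcc_of_le hbc]
    exact ⟨le_max_right _ _, max_le ht.2 hbc⟩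
  refine ⟨fun t => f (min t b) + g (max t b) - f b,
    (hleft.fun_add hright).fun_sub (absolutelyContinuousOnInterval_const _ _ _), fun t ht => ?_,
    fun t ht => ?_⟩
  · simp [min_eq_left (mem_Iic.1 ht), max_eq_right (mem_Iic.1 ht), hfg]
  · simp [min_eq_right (mem_Ici.1 ht), max_eq_left (mem_Ici.1 ht)]

theorem absolutelyContinuousOnInterval_trans {F : Type*} [SeminormedAddCommGroup F]
    {f : ℝ → F} {a b c : ℝ} (hab : a ≤ b) (hbc : b ≤ c)
    (hf : AbsolutelyContinuousOnInterval f a b) (hg : AbsolutelyContinuousOnInterval f b c) :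
    AbsolutelyContinuousOnInterval f a c := by
  obtain ⟨h, hac, hleft, hright⟩ := exists_absolutelyContinuousOnInterval_concat hab hbc hf hg rfl
  have hfh : h = f := funext fun t => (le_total t b).elim (fun ht => hleft ht) fun ht => hright ht
  exact hfh ▸ hac

theorem IsPiecewiseC1OnIic.absolutelyContinuousOnInterval {γ : ℝ → ℝ} (hγ : IsPiecewiseC1OnIic γ)
    {a : ℝ} (ha : a < 0) : AbsolutelyContinuousOnInterval γ a 0 := by
  obtain ⟨n, τ, h0, hn, hτ⟩ := hγ.2 a ha
  have hpieces : ∀ i ≤ n, τ 0 ≤ τ i ∧ AbsolutelyContinuousOnInterval γ (τ 0) (τ i) := by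
    intro i
    induction i with
    | zero =>
      refine fun _ => ⟨le_rfl, LipschitzOnWith.absolutelyContinuousOnInterval (K := 0) ?_⟩
      simp [LipschitzOnWith]
    | succ i ih =>
      intro hi
      obtain ⟨hle, hac⟩ := ih (by omega)
      obtain ⟨hlt, hC⟩ := hτ i (by omega)
      exact ⟨hle.trans hlt.le, absolutelyContinuousOnInterval_trans hle hlt.le hac
        (ContDiffOn.absolutelyContinuousOnInterval (by rwa [uIcc_of_le hlt.le]))⟩
  simpa [h0, hn] using (hpieces n le_rfl).2

end AbsoluteContinuity

section LeastAction

variable {U : ℝ → ℝ}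

theorem action_eq_setLIntegral_Ioo (γ : ℝ → ℝ) (a b : ℝ) :
    action U γ a b = ∫⁻ t in Ioo a b, ENNReal.ofReal (lagrangian U (deriv γ t) (γ t)) := by
  rw [action, restrict_Ioo_eq_restrict_Icc]

theorem action_eq_setLIntegral_Ioc (γ : ℝ → ℝ) (a b : ℝ) :
    action U γ a b = ∫⁻ t in Ioc a b, ENNReal.ofReal (lagrangian U (deriv γ t) (γ t)) := by
  rw [action, restrict_Ioc_eq_restrict_Icc]

theorem action_self (γ : ℝ → ℝ) (a : ℝ) : action U γ a a = 0 := by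
  simp [action]

theorem action_add (γ : ℝ → ℝ) {a b c : ℝ} (hab : a ≤ b) (hbc : b ≤ c) :
    action U γ a b + action U γ b c = action U γ a c := by
  simp only [action_eq_setLIntegral_Ioc]
  rw [← Ioc_union_Ioc_eq_Ioc hab hbc, lintegral_union measurableSet_Ioc
    (Ioc_disjoint_Ioc_of_le le_rfl)]

theorem action_mono (γ : ℝ → ℝ) {a b c d : ℝ} (h : Icc a b ⊆ Icc c d) :
    action U γ a b ≤ action U γ c d :=
  lintegral_mono_set h

theorem action_congr {γ₁ γ₂ : ℝ → ℝ} {a b : ℝ} (h : EqOn γ₁ γ₂ (Ioo a b)) :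
    action U γ₁ a b = action U γ₂ a b := by
  rw [action_eq_setLIntegral_Ioo, action_eq_setLIntegral_Ioo]
  refine setLIntegral_congr_fun measurableSet_Ioo fun t ht => ?_
  simp only [h ht, h.deriv isOpen_Ioo ht]

theorem action_comp_add_const (γ : ℝ → ℝ) (a b c : ℝ) :
    action U (fun t => γ (t + c)) a b = action U γ (a + c) (b + c) := by
  have hpre : (fun t => t + c) ⁻¹' Icc (a + c) (b + c) = Icc a b := by simp
  simp only [action, deriv_comp_add_const]
  rw [← hpre]
  exact (measurePreserving_add_right volume c).setLIntegral_comp_preimage_emb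
    (measurableEmbedding_addRight c)
    (fun t => ENNReal.ofReal (lagrangian U (deriv γ t) (γ t))) _

theorem action_add_intCast (hper : Function.Periodic (deriv U) 1) (γ : ℝ → ℝ) (a b : ℝ) (n : ℤ) :
    action U (fun t => γ t + n) a b = action U γ a b := by
  have hn (p : ℝ) : deriv U (p + n) = deriv U p := by simpa using hper.int_mul n p
  simp only [action, lagrangian, deriv_add_const, hn]

theorem unitAddCircle_coe_intCast (n : ℤ) : ((n : ℝ) : UnitAddCircle) = 0 :=
  (AddCircle.coe_eq_zero_iff 1).2 ⟨n, by simp⟩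

theorem exists_eq_add_intCast_of_coe_eq {p q : ℝ} (h : (p : UnitAddCircle) = q) :
    ∃ n : ℤ, p = q + n := by
  rw [← sub_eq_zero, ← AddCircle.coe_sub, AddCircle.coe_eq_zero_iff] at h
  obtain ⟨n, hn⟩ := h
  exact ⟨n, by rw [zsmul_one] at hn; linarith⟩

theorem exists_coe_eq_and_abs_eq_norm (z : UnitAddCircle) :
    ∃ e : ℝ, (e : UnitAddCircle) = z ∧ |e| = ‖z‖ := by
  obtain ⟨p, rfl⟩ := QuotientAddGroup.mk_surjective z
  refine ⟨p - round p, ?_, (UnitAddCircle.norm_eq).symm⟩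
  rw [AddCircle.coe_sub, unitAddCircle_coe_intCast, sub_zero]

theorem leastAction_le_action (γ : ℝ → ℝ) {a b : ℝ} (hγ : AbsolutelyContinuousOnInterval γ a b) :
    leastAction U (b - a) (γ b) (γ a) ≤ action U γ a b := by
  refine iInf₂_le_of_le (fun t => γ (t + a))
    (absolutelyContinuousOnInterval_comp_add_const (by simpa using hγ))
    (iInf₂_le_of_le (by simp) (by simp) ?_)
  simp [action_comp_add_const]

theorem le_leastAction {T : ℝ} {y x : UnitAddCircle} {r : ℝ≥0∞}
    (h : ∀ γ : ℝ → ℝ, AbsolutelyContinuousOnInterval γ 0 T → (γ 0 : UnitAddCircle) = x →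
      (γ T : UnitAddCircle) = y → r ≤ action U γ 0 T) : r ≤ leastAction U T y x :=
  le_iInf₂ fun γ hγ => le_iInf₂ (h γ hγ)

theorem le_leastAction_coe (hper : Function.Periodic (deriv U) 1) {T p : ℝ} {y : UnitAddCircle}
    {r : ℝ≥0∞} (h : ∀ γ : ℝ → ℝ, AbsolutelyContinuousOnInterval γ 0 T → γ 0 = p →
      (γ T : UnitAddCircle) = y → r ≤ action U γ 0 T) : r ≤ leastAction U T y p := by
  refine le_leastAction fun γ hγ h0 hT => ?_
  obtain ⟨n, hn⟩ := exists_eq_add_intCast_of_coe_eq h0.symm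
  rw [← action_add_intCast hper γ 0 T n]
  refine h _ (hγ.fun_add (absolutelyContinuousOnInterval_const _ _ _)) hn.symm ?_
  rw [AddCircle.coe_add, unitAddCircle_coe_intCast, add_zero, hT]

theorem leastAction_zero_self (y : UnitAddCircle) : leastAction U 0 y y = 0 := by
  obtain ⟨p, rfl⟩ := QuotientAddGroup.mk_surjective y
  refine le_antisymm ?_ zero_le
  simpa [action_self] using
    leastAction_le_action (U := U) _ (absolutelyContinuousOnInterval_const p 0 0)

theorem leastAction_add_le (hper : Function.Periodic (deriv U) 1) {S T : ℝ} (hS : 0 ≤ S)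
    (hT : 0 ≤ T) (y q x : UnitAddCircle) :
    leastAction U (S + T) y x ≤ leastAction U S q x + leastAction U T y q := by
  rw [← tsub_le_iff_right]
  refine le_leastAction fun γ₁ hγ₁ hx hq => ?_
  rw [tsub_le_iff_left, ← hq, ← tsub_le_iff_right]
  refine le_leastAction_coe hper fun γ₂ hγ₂ hγ₁₂ hy => ?_
  have hγ₂' : AbsolutelyContinuousOnInterval (fun t => γ₂ (t + -S)) S (S + T) :=
    absolutelyContinuousOnInterval_comp_add_const (by simpa using hγ₂)
  obtain ⟨γ, hγ, hleft, hright⟩ := exists_absolutelyContinuousOnInterval_concat hS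
    (le_add_of_nonneg_right hT) hγ₁ hγ₂' (by simp [hγ₁₂])
  have hact₁ : action U γ 0 S = action U γ₁ 0 S := action_congr (hleft.mono fun t ht => ht.2.le)
  have hact₂ : action U γ S (S + T) = action U γ₂ 0 T := by
    rw [action_congr (hright.mono fun t ht => ht.1.le), action_comp_add_const]
    simp
  rw [tsub_le_iff_left, ← hact₁, ← hact₂, action_add γ hS (le_add_of_nonneg_right hT)]
  have hend : γ (S + T) = γ₂ T := by
    rw [hright (mem_Ici.2 (le_add_of_nonneg_right hT))]
    simp
  simpa [hleft hS, hend, hx, hy] using leastAction_le_action (U := U) γ hγ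

theorem leastAction_add (hper : Function.Periodic (deriv U) 1) {S T : ℝ} (hS : 0 ≤ S)
    (hT : 0 ≤ T) (y x : UnitAddCircle) :
    leastAction U (S + T) y x = ⨅ q, (leastAction U S q x + leastAction U T y q) := by
  refine le_antisymm (le_iInf fun q => leastAction_add_le hper hS hT y q x) ?_
  refine le_leastAction fun γ hγ hx hy => iInf_le_of_le (γ S : UnitAddCircle) ?_
  have hST : S ≤ S + T := le_add_of_nonneg_right hT
  have hγ₁ : AbsolutelyContinuousOnInterval γ 0 S :=
    hγ.mono (uIcc_subset_uIcc_left (mem_uIcc_of_le hS hST))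
  have hγ₂ : AbsolutelyContinuousOnInterval γ S (S + T) :=
    hγ.mono (uIcc_subset_uIcc_right (mem_uIcc_of_le hS hST))
  rw [← action_add γ hS hST, ← hx, ← hy]
  gcongr
  · simpa using leastAction_le_action (U := U) γ hγ₁
  · simpa using leastAction_le_action (U := U) γ hγ₂

theorem absolutelyContinuousOnInterval_line (p v a b : ℝ) :
    AbsolutelyContinuousOnInterval (fun t => p + v * t) a b :=
  ContDiffOn.absolutelyContinuousOnInterval (by fun_prop)

theorem action_line_le {M : ℝ} (hM : ∀ p, |deriv U p| ≤ M) (p v T : ℝ) :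
    action U (fun t => p + v * t) 0 T ≤
      ENNReal.ofReal ((|v| + M) ^ 2 / 4) * ENNReal.ofReal T := by
  have hd (t : ℝ) : deriv (fun t => p + v * t) t = v := by simp
  calc action U (fun t => p + v * t) 0 T
      ≤ ∫⁻ _ in Icc 0 T, ENNReal.ofReal ((|v| + M) ^ 2 / 4) := by
        refine lintegral_mono fun t => ENNReal.ofReal_le_ofReal ?_
        have h : |v + deriv U (p + v * t)| ≤ |v| + M :=
          (abs_add_le _ _).trans (by gcongr; exact hM _)
        rw [hd, lagrangian, ← sq_abs]
        gcongr
    _ = ENNReal.ofReal ((|v| + M) ^ 2 / 4) * ENNReal.ofReal T := by simp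

theorem lineBarrier_ne_top {M : ℝ} (hM : ∀ p, |deriv U p| ≤ M) (q p : ℝ) :
    lineBarrier U q p ≠ ⊤ := by
  have h : lineBarrier U q p ≤ action U (fun t => p + (q - p) * t) 0 1 :=
    iInf₂_le_of_le 1 zero_le_one (iInf₂_le_of_le _ (absolutelyContinuousOnInterval_line _ _ _ _)
      (iInf₂_le_of_le (by simp) (by simp) le_rfl))
  exact ne_top_of_le_ne_top (by finiteness) (h.trans (action_line_le hM p (q - p) 1))

theorem leastAction_norm_sub_le {M : ℝ} (hM : ∀ p, |deriv U p| ≤ M) (y x : UnitAddCircle) :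
    leastAction U ‖y - x‖ y x ≤ ENNReal.ofReal ((1 + M) ^ 2 / 4) * ENNReal.ofReal ‖y - x‖ := by
  obtain ⟨p, rfl⟩ := QuotientAddGroup.mk_surjective x
  obtain ⟨e, he, habs⟩ := exists_coe_eq_and_abs_eq_norm (y - (p : UnitAddCircle))
  have hM0 : 0 ≤ M := (abs_nonneg _).trans (hM 0)
  have hsign : |(SignType.sign e : ℝ)| ≤ 1 := by cases SignType.sign e <;> simp
  obtain rfl : y = ((p + e : ℝ) : UnitAddCircle) := by rw [AddCircle.coe_add, he]; simp
  have h := leastAction_le_action (U := U) _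
    (absolutelyContinuousOnInterval_line p (SignType.sign e) 0 |e|)
  simp only [sign_mul_abs, mul_zero, add_zero, sub_zero] at h
  rw [← habs]
  refine h.trans ((action_line_le hM _ _ _).trans ?_)
  gcongr

theorem tendsto_leastAction_norm_sub {M : ℝ} (hM : ∀ p, |deriv U p| ≤ M) {ι : Type*}
    {l : Filter ι} {f g : ι → UnitAddCircle} (h : Tendsto (fun i => ‖f i - g i‖) l (nhds 0)) :
    Tendsto (fun i => leastAction U ‖f i - g i‖ (f i) (g i)) l (nhds 0) := by
  refine tendsto_of_tendsto_of_tendsto_of_le_of_le tendsto_const_nhds ?_ (fun _ => zero_le)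
    fun i => leastAction_norm_sub_le hM (f i) (g i)
  simpa using ENNReal.Tendsto.const_mul (ENNReal.tendsto_ofReal h) (Or.inr ENNReal.ofReal_ne_top)

end LeastAction

section PeierlsBarrier

variable {U : ℝ → ℝ}

theorem peierlsBarrier_le_of_tendsto {ι : Type*} {l : Filter ι} [l.NeBot] {T : ι → ℝ}
    {a : ι → ℝ≥0∞} {r : ℝ≥0∞} {y x : UnitAddCircle} (hT : Tendsto T l atTop)
    (ha : Tendsto a l (nhds r)) (hle : ∀ᶠ i in l, leastAction U (T i) y x ≤ a i) :
    peierlsBarrier U y x ≤ r :=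
  calc peierlsBarrier U y x ≤ liminf (fun i => leastAction U (T i) y x) l :=
        hT.liminf_le_liminf_comp
    _ ≤ liminf a l := liminf_le_liminf hle
    _ = r := ha.liminf_eq

theorem peierlsBarrier_le_add_leastAction (hper : Function.Periodic (deriv U) 1) {t : ℝ}
    (ht : 0 ≤ t) (y q x : UnitAddCircle) :
    peierlsBarrier U y x ≤ peierlsBarrier U q x + leastAction U t y q :=
  calc peierlsBarrier U y x ≤ liminf (fun T => leastAction U (T + t) y x) atTop :=
        (tendsto_atTop_add_const_right atTop t tendsto_id).liminf_le_liminf_comp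
    _ ≤ liminf (fun T => leastAction U T q x + leastAction U t y q) atTop :=
        liminf_le_liminf <| (eventually_ge_atTop 0).mono fun T hT =>
          leastAction_add_le hper hT ht y q x
    _ = peierlsBarrier U q x + leastAction U t y q :=
        liminf_add_const _ _ _ (by isBoundedDefault) (by isBoundedDefault)

variable {c : ℝ}

theorem leastAction_self_eq_zero (hc : deriv U c = 0) (T : ℝ) :
    leastAction U T (c : UnitAddCircle) c = 0 := by
  refine le_antisymm ?_ zero_le
  simpa [action, lagrangian, hc] using
    leastAction_le_action (U := U) _ (absolutelyContinuousOnInterval_const c 0 T)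

-- Waiting at `c` is free, so the least action from `c` is nonincreasing in the time.
theorem peierlsBarrier_le_leastAction (hper : Function.Periodic (deriv U) 1)
    (hc : deriv U c = 0) {T : ℝ} (hT : 0 ≤ T) (y : UnitAddCircle) :
    peierlsBarrier U y c ≤ leastAction U T y c := by
  refine peierlsBarrier_le_of_tendsto tendsto_id tendsto_const_nhds ?_
  filter_upwards [eventually_ge_atTop T] with S hS
  have h := leastAction_add_le hper (sub_nonneg.2 hS) hT y c c
  rwa [leastAction_self_eq_zero hc, zero_add, sub_add_cancel] at h

theorem peierlsBarrier_eq_iInf (hper : Function.Periodic (deriv U) 1) (hc : deriv U c = 0)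
    {t : ℝ} (ht : 0 ≤ t) (y : UnitAddCircle) :
    peierlsBarrier U y c = ⨅ (T : ℝ) (_ : 0 ≤ T), leastAction U (T + t) y c := by
  refine le_antisymm (le_iInf₂ fun T hT =>
    peierlsBarrier_le_leastAction hper hc (add_nonneg hT ht) y) ?_
  refine le_liminf_of_le (by isBoundedDefault) ?_
  filter_upwards [eventually_ge_atTop t] with T hT
  exact iInf₂_le_of_le (T - t) (sub_nonneg.2 hT) (by rw [sub_add_cancel])

theorem iInf_peierlsBarrier_add_leastAction (hper : Function.Periodic (deriv U) 1)
    (hc : deriv U c = 0) {t : ℝ} (ht : 0 ≤ t) (y : UnitAddCircle) :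
    ⨅ q, (peierlsBarrier U q c + leastAction U t y q) = peierlsBarrier U y c :=
  calc ⨅ q, (peierlsBarrier U q c + leastAction U t y q)
      = ⨅ q, ⨅ (T : ℝ) (_ : 0 ≤ T), (leastAction U T q c + leastAction U t y q) := by
        simp only [peierlsBarrier_eq_iInf hper hc le_rfl, add_zero, ENNReal.iInf_add]
    _ = ⨅ (T : ℝ) (_ : 0 ≤ T), ⨅ q, (leastAction U T q c + leastAction U t y q) := by
        rw [iInf_comm]
        exact iInf_congr fun T => iInf_comm
    _ = ⨅ (T : ℝ) (_ : 0 ≤ T), leastAction U (T + t) y c :=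
        iInf_congr fun T => iInf_congr fun hT => (leastAction_add hper hT ht y c).symm
    _ = peierlsBarrier U y c := (peierlsBarrier_eq_iInf hper hc ht y).symm

theorem peierlsBarrier_ne_top (hper : Function.Periodic (deriv U) 1) {M : ℝ}
    (hM : ∀ p, |deriv U p| ≤ M) (hc : deriv U c = 0) (y : UnitAddCircle) :
    peierlsBarrier U y c ≠ ⊤ :=
  ne_top_of_le_ne_top (by finiteness)
    ((peierlsBarrier_le_leastAction hper hc (norm_nonneg _) y).trans
      (leastAction_norm_sub_le hM y c))

theorem coe_mem_projectedAubrySet (hper : Function.Periodic (deriv U) 1) (hc : deriv U c = 0) :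
    (c : UnitAddCircle) ∈ projectedAubrySet U :=
  le_antisymm ((peierlsBarrier_le_leastAction hper hc le_rfl _).trans
    (leastAction_zero_self _).le) zero_le

end PeierlsBarrier

section Subsolutions

variable {U : ℝ → ℝ}

theorem mul_sub_hamiltonian_le_lagrangian (U : ℝ → ℝ) (s p q : ℝ) :
    s * p - hamiltonian U p q ≤ lagrangian U s q :=
  (isLUB_lagrangian U s q).1 (mem_range_self p)

theorem ofReal_integral_le_setLIntegral_ofReal {f : ℝ → ℝ} {a b : ℝ} (hab : a ≤ b)
    (hf : IntervalIntegrable f volume a b) :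
    ENNReal.ofReal (∫ t in a..b, f t) ≤ ∫⁻ t in Ioc a b, ENNReal.ofReal (f t) := by
  rw [intervalIntegral.integral_of_le hab]
  have hi : Integrable f (volume.restrict (Ioc a b)) := hf.1
  calc ENNReal.ofReal (∫ t in Ioc a b, f t)
      ≤ ENNReal.ofReal (∫ t in Ioc a b, max (f t) 0) :=
        ENNReal.ofReal_le_ofReal (integral_mono hi hi.pos_part fun t => le_max_left _ _)
    _ = ∫⁻ t in Ioc a b, ENNReal.ofReal (max (f t) 0) :=
        ofReal_integral_eq_lintegral_ofReal hi.pos_part (ae_of_all _ fun t => le_max_right _ _)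
    _ = ∫⁻ t in Ioc a b, ENNReal.ofReal (f t) := by simp [ENNReal.ofReal_max]

theorem ofReal_sub_sub_le_action {φ γ : ℝ → ℝ} {a b C : ℝ} (hφ : ContDiff ℝ 1 φ) (hab : a ≤ b)
    (hγ : AbsolutelyContinuousOnInterval γ a b)
    (hC : ∀ t ∈ Icc a b, hamiltonian U (deriv φ (γ t)) (γ t) ≤ C) :
    ENNReal.ofReal (φ (γ b) - φ (γ a) - C * (b - a)) ≤ action U γ a b := by
  have hφγ := absolutelyContinuousOnInterval_comp_of_contDiff hφ hγ
  have hint : IntervalIntegrable (fun t => deriv (fun s => φ (γ s)) t - C) volume a b :=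
    hφγ.intervalIntegrable_deriv.sub intervalIntegrable_const
  have hvalue : φ (γ b) - φ (γ a) - C * (b - a) =
      ∫ t in a..b, (deriv (fun s => φ (γ s)) t - C) := by
    rw [intervalIntegral.integral_sub hφγ.intervalIntegrable_deriv intervalIntegrable_const,
      hφγ.integral_deriv_eq_sub, intervalIntegral.integral_const, smul_eq_mul, mul_comm C]
  have hle : ∀ᵐ t, t ∈ Ioc a b →
      deriv (fun s => φ (γ s)) t - C ≤ lagrangian U (deriv γ t) (γ t) := by
    filter_upwards [hγ.ae_differentiableAt] with t hdiff ht
    have ht' : t ∈ Icc a b := Ioc_subset_Icc_self ht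
    have hchain : deriv (fun s => φ (γ s)) t = deriv γ t * deriv φ (γ t) := by
      rw [mul_comm]
      exact deriv_comp t (hφ.differentiable one_ne_zero (γ t)) (hdiff (by rwa [uIcc_of_le hab]))
    have hyoung := mul_sub_hamiltonian_le_lagrangian U (deriv γ t) (deriv φ (γ t)) (γ t)
    linarith [hC t ht']
  rw [hvalue, action_eq_setLIntegral_Ioc]
  refine (ofReal_integral_le_setLIntegral_ofReal hab hint).trans (lintegral_mono_ae ?_)
  exact (ae_restrict_iff' measurableSet_Ioc).2
    (hle.mono fun t h ht => ENNReal.ofReal_le_ofReal (h ht))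

theorem ofReal_abs_sub_sub_le_action {M : ℝ} (hM : ∀ p, |deriv U p| ≤ M) {γ : ℝ → ℝ} {a b : ℝ}
    (hab : a ≤ b) (hγ : AbsolutelyContinuousOnInterval γ a b) :
    ENNReal.ofReal (|γ b - γ a| - (1 + M) * (b - a)) ≤ action U γ a b := by
  have hright := ofReal_sub_sub_le_action (U := U) (C := 1 + M) contDiff_id hab hγ
    fun t _ => by
      simp only [hamiltonian, deriv_id]
      linarith [neg_abs_le (deriv U (γ t)), hM (γ t)]
  have hleft := ofReal_sub_sub_le_action (U := U) (C := 1 + M) contDiff_neg hab hγ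
    fun t _ => by
      simp only [hamiltonian, deriv_neg]
      linarith [le_abs_self (deriv U (γ t)), hM (γ t)]
  rcases abs_choice (γ b - γ a) with h | h
  · simpa only [h, id] using hright
  · simpa only [h, neg_sub, sub_neg_eq_add, neg_add_eq_sub] using hleft

/-- A `C¹` subsolution of the Hamilton–Jacobi equation `H(φ'(p), p) = 0` on the circle, given by
its `1`-periodic lift to `ℝ`. -/
structure IsPeriodicSubsolution (U φ : ℝ → ℝ) : Prop where
  contDiff : ContDiff ℝ 1 φ
  periodic : Function.Periodic φ 1
  hamiltonian_le_zero : ∀ p, hamiltonian U (deriv φ p) p ≤ 0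

namespace IsPeriodicSubsolution

variable {φ : ℝ → ℝ}

-- Either the loop leaves the `δ`-ball before time `τ`, or it spends this time where `φ` is strict.
theorem ofReal_min_le_action_of_loop (hφ : IsPeriodicSubsolution U φ) {M : ℝ}
    (hM : ∀ p, |deriv U p| ≤ M) {γ : ℝ → ℝ} {T τ δ m : ℝ} (hτ : 0 ≤ τ) (hτT : τ ≤ T)
    (hγ : AbsolutelyContinuousOnInterval γ 0 T) (hloop : (γ T : UnitAddCircle) = γ 0)
    (hm : ∀ p, |p - γ 0| < δ → hamiltonian U (deriv φ p) p ≤ -m) :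
    ENNReal.ofReal (min (δ - (1 + M) * τ) (m * τ)) ≤ action U γ 0 T := by
  have hM0 : 0 ≤ M := (abs_nonneg _).trans (hM 0)
  have hsub {t : ℝ} (ht : t ∈ Icc 0 T) : AbsolutelyContinuousOnInterval γ 0 t :=
    hγ.mono (uIcc_subset_uIcc_left (mem_uIcc_of_le ht.1 ht.2))
  by_cases hesc : ∃ t ∈ Icc 0 τ, δ ≤ |γ t - γ 0|
  · obtain ⟨t, ht, hδ⟩ := hesc
    have htT : t ≤ T := ht.2.trans hτT
    calc ENNReal.ofReal (min (δ - (1 + M) * τ) (m * τ))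
        ≤ ENNReal.ofReal (|γ t - γ 0| - (1 + M) * (t - 0)) := by
          refine ENNReal.ofReal_le_ofReal ((min_le_left _ _).trans ?_)
          rw [sub_zero]
          gcongr
          exact ht.2
      _ ≤ action U γ 0 t := ofReal_abs_sub_sub_le_action hM ht.1 (hsub ⟨ht.1, htT⟩)
      _ ≤ action U γ 0 T := action_mono γ (Icc_subset_Icc_right htT)
  · push Not at hesc
    have hstart := ofReal_sub_sub_le_action (U := U) hφ.contDiff hτ (hsub ⟨hτ, hτT⟩)
      fun t ht => hm _ (hesc t ht)
    have hend := ofReal_sub_sub_le_action (U := U) hφ.contDiff hτT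
      (hγ.mono (uIcc_subset_uIcc_right (mem_uIcc_of_le hτ hτT)))
      fun t _ => hφ.hamiltonian_le_zero (γ t)
    have hφT : φ (γ T) = φ (γ 0) := by
      obtain ⟨n, hn⟩ := exists_eq_add_intCast_of_coe_eq hloop
      rw [hn]
      simpa using hφ.periodic.int_mul n (γ 0)
    rw [← action_add γ hτ hτT]
    refine le_trans ?_ (add_le_add hstart hend)
    refine (ENNReal.ofReal_le_ofReal (min_le_right _ _)).trans (le_trans ?_ ENNReal.ofReal_add_le)
    rw [hφT]
    exact ENNReal.ofReal_le_ofReal (by linarith)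

theorem peierlsBarrier_self_pos (hφ : IsPeriodicSubsolution U φ)
    (hper : Function.Periodic (deriv U) 1) (hcont : Continuous (deriv U)) {M : ℝ}
    (hM : ∀ p, |deriv U p| ≤ M) {r : ℝ} (hr : hamiltonian U (deriv φ r) r < 0) :
    0 < peierlsBarrier U (r : UnitAddCircle) r := by
  have hM0 : 0 ≤ M := (abs_nonneg _).trans (hM 0)
  obtain ⟨m, hrm, hm0⟩ := exists_between hr
  have hHcont : Continuous fun p => hamiltonian U (deriv φ p) p := by
    have := hφ.contDiff.continuous_deriv le_rfl
    unfold hamiltonian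
    fun_prop
  obtain ⟨δ, hδ, hball⟩ : ∃ δ > 0, ∀ p, |p - r| < δ → hamiltonian U (deriv φ p) p < m :=
    Metric.eventually_nhds_iff.1 (hHcont.continuousAt.eventually_lt_const hrm)
  set τ := δ / (2 * (1 + M)) with hτ
  have hτ0 : 0 < τ := by positivity
  have hMτ : (1 + M) * τ = δ / 2 := by rw [hτ]; field_simp
  have hpos : 0 < min (δ - (1 + M) * τ) (-m * τ) :=
    lt_min (by linarith) (mul_pos (neg_pos.2 hm0) hτ0)
  refine (ENNReal.ofReal_pos.2 hpos).trans_le (le_liminf_of_le (by isBoundedDefault) ?_)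
  filter_upwards [eventually_ge_atTop τ] with T hT
  refine le_leastAction_coe hper fun γ hγ h0 hloop => ?_
  refine hφ.ofReal_min_le_action_of_loop hM hτ0.le hT hγ (by rw [hloop, h0]) fun p hp => ?_
  rw [neg_neg]
  exact (hball p (by rwa [← h0])).le

end IsPeriodicSubsolution

theorem exists_contDiff_periodic_deriv_eq {ψ : ℝ → ℝ} {T : ℝ} (hψ : Continuous ψ)
    (hper : Function.Periodic ψ T) (hzero : ∫ p in (0 : ℝ)..T, ψ p = 0) :
    ∃ φ : ℝ → ℝ, ContDiff ℝ 1 φ ∧ Function.Periodic φ T ∧ deriv φ = ψ := by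
  have hderiv : deriv (fun p => ∫ q in (0 : ℝ)..p, ψ q) = ψ := funext fun p =>
    hψ.deriv_integral ψ 0 p
  refine ⟨fun p => ∫ q in (0 : ℝ)..p, ψ q, contDiff_one_iff_deriv.2 ⟨fun p =>
    (hψ.integral_hasStrictDerivAt 0 p).hasDerivAt.differentiableAt, by rwa [hderiv]⟩,
    fun p => ?_, hderiv⟩
  have h := hper.intervalIntegral_add_eq p 0
  rw [zero_add, hzero] at h
  simp only
  rw [← intervalIntegral.integral_add_adjacent_intervals (hψ.intervalIntegrable 0 p)
    (hψ.intervalIntegrable p (p + T)), h, add_zero]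

theorem integral_pos_of_periodic {f : ℝ → ℝ} {T : ℝ} (hT : 0 < T) (hper : Function.Periodic f T)
    (hf : Continuous f) (h0 : ∀ p, 0 ≤ f p) (hpos : ∃ p, 0 < f p) :
    0 < ∫ p in (0 : ℝ)..T, f p := by
  obtain ⟨p, hp⟩ := hpos
  obtain ⟨q, hq, hpq⟩ := hper.exists_mem_Ico₀ hT p
  exact intervalIntegral.integral_pos hT hf.continuousOn (fun t _ => h0 t)
    ⟨q, Ico_subset_Icc_self hq, hpq ▸ hp⟩

theorem exists_integral_posPart_sub_negPart_eq_zero {F : ℝ → ℝ} {T : ℝ} (hT : 0 < T)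
    (hper : Function.Periodic F T) (hF : Continuous F) (hpos : ∃ p, 0 < F p)
    (hneg : ∃ p, F p < 0) :
    ∃ s ∈ Ioo (0 : ℝ) 1, ∫ p in (0 : ℝ)..T, (s * max (F p) 0 - (1 - s) * max (-F p) 0) = 0 := by
  set A := ∫ p in (0 : ℝ)..T, max (F p) 0 with hA
  set B := ∫ p in (0 : ℝ)..T, max (-F p) 0 with hB
  have hApos : 0 < A := integral_pos_of_periodic hT (fun p => by simp only [hper p]) (by fun_prop)
    (fun p => le_max_right _ _) (hpos.imp fun p hp => lt_max_of_lt_left hp)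
  have hBpos : 0 < B := integral_pos_of_periodic hT (fun p => by simp only [hper p]) (by fun_prop)
    (fun p => le_max_right _ _) (hneg.imp fun p hp => lt_max_of_lt_left (neg_pos.2 hp))
  refine ⟨B / (A + B), ⟨by positivity, (div_lt_one (by positivity)).2 (by linarith)⟩, ?_⟩
  rw [intervalIntegral.integral_sub (Continuous.intervalIntegrable (by fun_prop) _ _)
    (Continuous.intervalIntegrable (by fun_prop) _ _), intervalIntegral.integral_const_mul,
    intervalIntegral.integral_const_mul, ← hA, ← hB]
  field_simp
  ring

theorem hamiltonian_posPart_sub_negPart (U : ℝ → ℝ) (s q : ℝ) :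
    hamiltonian U (s * max (deriv U q) 0 - (1 - s) * max (-deriv U q) 0) q =
      -(s * (1 - s) * deriv U q ^ 2) := by
  rw [hamiltonian]
  rcases le_total (deriv U q) 0 with h | h
  · rw [max_eq_right h, max_eq_left (neg_nonneg.2 h)]
    ring
  · rw [max_eq_left h, max_eq_right (neg_nonpos.2 h)]
    ring

theorem exists_isPeriodicSubsolution (hper : Function.Periodic (deriv U) 1)
    (hcont : Continuous (deriv U)) (hpos : ∃ p, 0 < deriv U p) (hneg : ∃ p, deriv U p < 0) :
    ∃ φ, IsPeriodicSubsolution U φ ∧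
      ∀ p, deriv U p ≠ 0 → hamiltonian U (deriv φ p) p < 0 := by
  obtain ⟨s, ⟨hs0, hs1⟩, hzero⟩ :=
    exists_integral_posPart_sub_negPart_eq_zero one_pos hper hcont hpos hneg
  obtain ⟨φ, hφ, hφper, hderiv⟩ := exists_contDiff_periodic_deriv_eq (by fun_prop)
    (fun p => by simp only [hper p]) hzero
  have hH (p : ℝ) : hamiltonian U (deriv φ p) p = -(s * (1 - s) * deriv U p ^ 2) := by
    rw [hderiv, hamiltonian_posPart_sub_negPart]
  have hs : 0 < s * (1 - s) := mul_pos hs0 (sub_pos.2 hs1)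
  refine ⟨φ, ⟨hφ, hφper, fun p => ?_⟩, fun p hp => ?_⟩
  · rw [hH, neg_nonpos]
    exact mul_nonneg hs.le (sq_nonneg _)
  · rw [hH, neg_lt_zero]
    exact mul_pos hs (sq_pos_of_ne_zero hp)

theorem projectedAubrySet_eq (hper : Function.Periodic (deriv U) 1) (hcont : Continuous (deriv U))
    {M : ℝ} (hM : ∀ p, |deriv U p| ≤ M) (hpos : ∃ p, 0 < deriv U p) (hneg : ∃ p, deriv U p < 0) :
    projectedAubrySet U = (fun p : ℝ => (p : UnitAddCircle)) '' {p | deriv U p = 0} := by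
  refine Subset.antisymm (fun x hx => ?_) (image_subset_iff.2 fun p hp =>
    coe_mem_projectedAubrySet hper hp)
  obtain ⟨r, rfl⟩ := QuotientAddGroup.mk_surjective x
  obtain ⟨φ, hφ, hstrict⟩ := exists_isPeriodicSubsolution hper hcont hpos hneg
  refine ⟨r, ?_, rfl⟩
  by_contra hr
  exact (hφ.peierlsBarrier_self_pos hper hcont hM (hstrict r hr)).ne' hx

end Subsolutions

section WeakKAM

variable {U : ℝ → ℝ} {w : UnitAddCircle → ℝ}

theorem ereal_coe_sub_le_coe_ennreal_iff {r s : ℝ} {a : ℝ≥0∞} :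
    ((r - s : ℝ) : EReal) ≤ a ↔ ENNReal.ofReal (r - s) ≤ a := by
  rw [← EReal.coe_ennreal_le_coe_ennreal_iff, EReal.coe_ennreal_ofReal,
    EReal.coe_strictMono.monotone.map_max, max_le_iff]
  exact (and_iff_left (EReal.coe_ennreal_nonneg a)).symm

theorem ereal_coe_le_coe_add_coe_ennreal_iff {r s : ℝ} {a : ℝ≥0∞} :
    (r : EReal) ≤ s + a ↔ ENNReal.ofReal (r - s) ≤ a := by
  rw [← ereal_coe_sub_le_coe_ennreal_iff, EReal.coe_sub,
    EReal.sub_le_iff_le_add (Or.inl (EReal.coe_ne_bot s)) (Or.inl (EReal.coe_ne_top s)), add_comm]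

theorem ereal_coe_add_coe_ennreal_le_coe {r s : ℝ} {a : ℝ≥0∞} (h : s ≤ r)
    (ha : a ≤ ENNReal.ofReal (r - s)) : (s : EReal) + a ≤ r :=
  calc (s : EReal) + a ≤ s + (ENNReal.ofReal (r - s) : ℝ≥0∞) := by
        gcongr
        exact EReal.coe_ennreal_le_coe_ennreal_iff.2 ha
    _ = r := by
        rw [EReal.coe_ennreal_ofReal, max_eq_left (sub_nonneg.2 h), ← EReal.coe_add,
          add_sub_cancel]

theorem manePotential_self (y : UnitAddCircle) : manePotential U y y = 0 :=
  le_antisymm (iInf₂_le_of_le 0 le_rfl (leastAction_zero_self y).le) zero_le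

/-- `w` is calibrated along the backward trajectory `c` on the circle, where `c s` is the position
at time `-s`: moving from `c t` to `c s` in time `t - s` costs no more than the increment of `w`,
which is the least possible cost when `w` is a weak KAM solution. -/
def IsBackwardCalibrated (U : ℝ → ℝ) (w : UnitAddCircle → ℝ) (c : ℝ → UnitAddCircle) : Prop :=
  ∀ ⦃s t : ℝ⦄, 0 ≤ s → s ≤ t →
    w (c t) ≤ w (c s) ∧ leastAction U (t - s) (c s) (c t) ≤ ENNReal.ofReal (w (c s) - w (c t))

namespace IsBackwardCalibrated

variable {c : ℝ → UnitAddCircle} {τ : ℕ → ℝ} {q : UnitAddCircle} {M : ℝ}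

theorem le_and_peierlsBarrier_le_of_tendsto (hc : IsBackwardCalibrated U w c) (hw : Continuous w)
    (hper : Function.Periodic (deriv U) 1) (hM : ∀ p, |deriv U p| ≤ M)
    (hτ : Tendsto τ atTop atTop) (hq : Tendsto (fun n => c (τ n)) atTop (nhds q)) {s : ℝ}
    (hs : 0 ≤ s) :
    w q ≤ w (c s) ∧ peierlsBarrier U (c s) q ≤ ENNReal.ofReal (w (c s) - w q) := by
  have hwq : Tendsto (fun n => w (c (τ n))) atTop (nhds (w q)) := (hw.tendsto q).comp hq
  have hlate : ∀ᶠ n in atTop, s ≤ τ n := hτ.eventually_ge_atTop s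
  refine ⟨le_of_tendsto hwq (hlate.mono fun n hn => (hc hs hn).1), ?_⟩
  have htime : Tendsto (fun n => ‖c (τ n) - q‖ + (τ n - s)) atTop atTop :=
    (tendsto_atTop_add_const_right _ (-s) hτ).nonneg_add_atTop fun n => norm_nonneg _
  have hcost : Tendsto (fun n => leastAction U ‖c (τ n) - q‖ (c (τ n)) q +
      ENNReal.ofReal (w (c s) - w (c (τ n)))) atTop (nhds (0 + ENNReal.ofReal (w (c s) - w q))) :=
    (tendsto_leastAction_norm_sub hM (tendsto_iff_norm_sub_tendsto_zero.1 hq)).add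
      (ENNReal.tendsto_ofReal (hwq.const_sub _))
  rw [zero_add] at hcost
  refine peierlsBarrier_le_of_tendsto htime hcost (hlate.mono fun n hn => ?_)
  exact (leastAction_add_le hper (norm_nonneg _) (sub_nonneg.2 hn) _ (c (τ n)) _).trans
    (by gcongr; exact (hc hs hn).2)

theorem mem_projectedAubrySet_of_tendsto (hc : IsBackwardCalibrated U w c) (hw : Continuous w)
    (hper : Function.Periodic (deriv U) 1) (hM : ∀ p, |deriv U p| ≤ M)
    (hτ : Tendsto τ atTop atTop) (hq : Tendsto (fun n => c (τ n)) atTop (nhds q)) :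
    q ∈ projectedAubrySet U := by
  have hdist : Tendsto (fun n => ‖q - c (τ n)‖) atTop (nhds 0) := by
    simpa only [norm_sub_rev q] using tendsto_iff_norm_sub_tendsto_zero.1 hq
  have hcost : Tendsto (fun n => ENNReal.ofReal (w (c (τ n)) - w q) +
      leastAction U ‖q - c (τ n)‖ q (c (τ n))) atTop (nhds (ENNReal.ofReal (w q - w q) + 0)) :=
    (ENNReal.tendsto_ofReal (((hw.tendsto q).comp hq).sub_const _)).add
      (tendsto_leastAction_norm_sub hM hdist)
  rw [sub_self, ENNReal.ofReal_zero, add_zero] at hcost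
  refine le_antisymm (ge_of_tendsto hcost ?_) zero_le
  filter_upwards [hτ.eventually_ge_atTop 0] with n hn
  refine (peierlsBarrier_le_add_leastAction hper (norm_nonneg (q - c (τ n))) q (c (τ n)) q).trans ?_
  gcongr
  exact (hc.le_and_peierlsBarrier_le_of_tendsto hw hper hM hτ hq hn).2

theorem exists_mem_projectedAubrySet (hc : IsBackwardCalibrated U w c) (hw : Continuous w)
    (hper : Function.Periodic (deriv U) 1) (hM : ∀ p, |deriv U p| ≤ M) :
    ∃ q ∈ projectedAubrySet U,
      w q ≤ w (c 0) ∧ peierlsBarrier U (c 0) q ≤ ENNReal.ofReal (w (c 0) - w q) := by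
  obtain ⟨q, -, φ, hφ, hq⟩ := isCompact_univ.tendsto_subseq fun n : ℕ => mem_univ (c n)
  have hτ : Tendsto (fun n => (φ n : ℝ)) atTop atTop :=
    tendsto_natCast_atTop_atTop.comp hφ.tendsto_atTop
  exact ⟨q, hc.mem_projectedAubrySet_of_tendsto hw hper hM hτ hq,
    hc.le_and_peierlsBarrier_le_of_tendsto hw hper hM hτ hq le_rfl⟩

end IsBackwardCalibrated

namespace IsWeakKAMSolution

theorem ofReal_sub_le_leastAction (hw : IsWeakKAMSolution U w) {T : ℝ} (hT : 0 ≤ T)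
    (y q : UnitAddCircle) : ENNReal.ofReal (w y - w q) ≤ leastAction U T y q := by
  refine le_leastAction fun γ hγ hq hy => ?_
  rw [← ereal_coe_sub_le_coe_ennreal_iff, ← hq, ← hy]
  exact hw.dominated γ 0 T hT hγ

theorem ofReal_sub_le_peierlsBarrier (hw : IsWeakKAMSolution U w) (y q : UnitAddCircle) :
    ENNReal.ofReal (w y - w q) ≤ peierlsBarrier U y q :=
  le_liminf_of_le (by isBoundedDefault) <|
    (eventually_ge_atTop 0).mono fun _ hT => hw.ofReal_sub_le_leastAction hT y q

theorem exists_isBackwardCalibrated (hw : IsWeakKAMSolution U w) (y : UnitAddCircle) :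
    ∃ c, c 0 = y ∧ IsBackwardCalibrated U w c := by
  obtain ⟨γ, h0, hγ, hcal⟩ := hw.calibrated y
  refine ⟨fun s => γ (-s), by simpa using h0, fun s t hs hst => ?_⟩
  rcases hst.eq_or_lt with rfl | hlt
  · simp [leastAction_zero_self]
  have hac : AbsolutelyContinuousOnInterval γ (-t) (-s) :=
    (hγ.absolutelyContinuousOnInterval (by linarith : -t < 0)).mono
      (uIcc_subset_uIcc_left (mem_uIcc_of_le (by linarith) (by linarith)))
  have heq := hcal (-t) (-s) (by linarith) (by linarith)
  have hle : w (γ (-t)) ≤ w (γ (-s)) := by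
    rw [← sub_nonneg, ← EReal.coe_nonneg, heq]
    exact EReal.coe_ennreal_nonneg _
  have haction : action U γ (-t) (-s) = ENNReal.ofReal (w (γ (-s)) - w (γ (-t))) := by
    rw [← EReal.coe_ennreal_eq_coe_ennreal_iff, ← heq, EReal.coe_ennreal_ofReal,
      max_eq_left (sub_nonneg.2 hle)]
  refine ⟨hle, haction ▸ ?_⟩
  convert leastAction_le_action (U := U) γ hac using 2
  ring

theorem laxOleinik_eq (hw : IsWeakKAMSolution U w) {t : ℝ} (ht : 0 ≤ t) (y : UnitAddCircle) :
    laxOleinik U t (fun q => (w q : EReal)) y = w y := by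
  refine le_antisymm ?_ (le_iInf fun q =>
    ereal_coe_le_coe_add_coe_ennreal_iff.2 (hw.ofReal_sub_le_leastAction ht y q))
  obtain ⟨c, rfl, hc⟩ := hw.exists_isBackwardCalibrated y
  obtain ⟨hle, hcost⟩ := hc le_rfl ht
  rw [sub_zero] at hcost
  exact iInf_le_of_le (c t) (ereal_coe_add_coe_ennreal_le_coe hle hcost)

theorem eq_iInf_manePotential (hw : IsWeakKAMSolution U w) (y : UnitAddCircle) :
    (w y : EReal) = ⨅ q : UnitAddCircle, ((w q : EReal) + (manePotential U y q : EReal)) :=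
  le_antisymm
    (le_iInf fun q => ereal_coe_le_coe_add_coe_ennreal_iff.2
      (le_iInf₂ fun _ hT => hw.ofReal_sub_le_leastAction hT y q))
    (iInf_le_of_le y (by simp [manePotential_self]))

theorem eq_iInf_peierlsBarrier (hw : IsWeakKAMSolution U w)
    (hper : Function.Periodic (deriv U) 1) {M : ℝ} (hM : ∀ p, |deriv U p| ≤ M)
    (y : UnitAddCircle) :
    (w y : EReal) =
      ⨅ q ∈ projectedAubrySet U, ((w q : EReal) + (peierlsBarrier U y q : EReal)) := by
  refine le_antisymm (le_iInf₂ fun q _ =>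
    ereal_coe_le_coe_add_coe_ennreal_iff.2 (hw.ofReal_sub_le_peierlsBarrier y q)) ?_
  obtain ⟨c, rfl, hc⟩ := hw.exists_isBackwardCalibrated y
  obtain ⟨q, hq, hle, hcost⟩ := hc.exists_mem_projectedAubrySet hw.continuous hper hM
  exact iInf₂_le_of_le q hq (ereal_coe_add_coe_ennreal_le_coe hle hcost)

end IsWeakKAMSolution

end WeakKAM

section FreidlinWentzell

variable {U : ℝ → ℝ} {k : ℕ} {x : ℤ → ℝ}

theorem ereal_coe_ennreal_iInf {ι : Type*} [Nonempty ι] (f : ι → ℝ≥0∞) :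
    ((⨅ i, f i : ℝ≥0∞) : EReal) = ⨅ i, (f i : EReal) :=
  EReal.coe_ennreal_strictMono.monotone.map_ciInf_of_continuousAt
    continuous_coe_ennreal_ereal.continuousAt

theorem laxOleinik_coe_ennreal (t : ℝ) (u : UnitAddCircle → ℝ≥0∞) (y : UnitAddCircle) :
    laxOleinik U t (fun q => (u q : EReal)) y =
      ((⨅ q, (u q + leastAction U t y q) : ℝ≥0∞) : EReal) := by
  simp only [laxOleinik, ereal_coe_ennreal_iInf, EReal.coe_ennreal_add]

theorem laxOleinik_iInf_add_peierlsBarrier (hper : Function.Periodic (deriv U) 1) {ι : Sort*}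
    (a : ι → ℝ≥0∞) {c : ι → ℝ} (hc : ∀ i, deriv U (c i) = 0) {t : ℝ} (ht : 0 ≤ t)
    (y : UnitAddCircle) :
    laxOleinik U t (fun q => ((⨅ i, (a i + peierlsBarrier U q (c i)) : ℝ≥0∞) : EReal)) y =
      ((⨅ i, (a i + peierlsBarrier U y (c i)) : ℝ≥0∞) : EReal) := by
  rw [laxOleinik_coe_ennreal]
  congr 1
  calc ⨅ q, ((⨅ i, (a i + peierlsBarrier U q (c i))) + leastAction U t y q)
      = ⨅ i, ⨅ q, (a i + (peierlsBarrier U q (c i) + leastAction U t y q)) := by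
        simp only [ENNReal.iInf_add, add_assoc]
        exact iInf_comm
    _ = ⨅ i, (a i + peierlsBarrier U y (c i)) := by
        simp only [← ENNReal.add_iInf, iInf_peierlsBarrier_add_leastAction hper (hc _) ht]

theorem laxOleinik_freidlinWentzell (hper : Function.Periodic (deriv U) 1)
    (hx : ∀ i ∈ Icc (1 : ℤ) k, deriv U (x i) = 0) {t : ℝ} (ht : 0 ≤ t) (y : UnitAddCircle) :
    laxOleinik U t (fun q => (freidlinWentzell U k x q : EReal)) y = freidlinWentzell U k x y := by
  simp only [freidlinWentzell, iInf_subtype']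
  exact laxOleinik_iInf_add_peierlsBarrier hper _ (c := fun i : Icc (1 : ℤ) k => x i)
    (fun i => hx i i.2) ht y

theorem boundaryValue_ne_top {M : ℝ} (hM : ∀ p, |deriv U p| ≤ M) (hk : 0 < k) (i : ℤ) :
    boundaryValue U k x i ≠ ⊤ := by
  have hright : costRight U k x i 1 ≠ ⊤ := by
    rw [costRight]
    split_ifs <;> exact lineBarrier_ne_top hM _ _
  have hleft : costLeft U k x i 1 ≠ ⊤ := by
    rw [costLeft]
    split_ifs <;> exact lineBarrier_ne_top hM _ _
  exact ne_top_of_le_ne_top (ENNReal.add_ne_top.2 ⟨hright, hleft⟩)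
    (iInf₂_le 1 ⟨le_rfl, by exact_mod_cast hk⟩)

theorem freidlinWentzell_ne_top (hper : Function.Periodic (deriv U) 1) {M : ℝ}
    (hM : ∀ p, |deriv U p| ≤ M) (hk : 0 < k) (hx : deriv U (x 1) = 0) (y : UnitAddCircle) :
    freidlinWentzell U k x y ≠ ⊤ :=
  ne_top_of_le_ne_top
    (ENNReal.add_ne_top.2 ⟨boundaryValue_ne_top hM hk 1, peierlsBarrier_ne_top hper hM hx y⟩)
    (iInf₂_le 1 ⟨le_rfl, by exact_mod_cast hk⟩)

end FreidlinWentzell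

section CriticalPoints

variable {U : ℝ → ℝ}

theorem exists_deriv_pos_of_isLocalMin {c : ℝ} (hdiff : Differentiable ℝ U)
    (hdense : Dense {p | deriv U p ≠ 0}) (hmin : IsLocalMin U c) : ∃ p, 0 < deriv U p := by
  by_contra! hle
  have hanti : Antitone U := antitone_of_deriv_nonpos hdiff hle
  obtain ⟨δ, hδ, hball⟩ := Metric.eventually_nhds_iff.1 hmin
  have hconst : EqOn U (fun _ => U c) (Ioo c (c + δ)) := fun p hp =>
    le_antisymm (hanti hp.1.le) (hball (by
      rw [Real.dist_eq, abs_of_pos (sub_pos.2 hp.1)]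
      linarith [hp.2]))
  obtain ⟨p, hp, hp0⟩ := hdense.inter_open_nonempty _ isOpen_Ioo
    (nonempty_Ioo.2 (lt_add_of_pos_right c hδ))
  exact hp0 (by rw [hconst.deriv isOpen_Ioo hp, deriv_const])

theorem exists_deriv_neg_of_isLocalMin {c : ℝ} (hdiff : Differentiable ℝ U)
    (hdense : Dense {p | deriv U p ≠ 0}) (hmin : IsLocalMin U c) : ∃ p, deriv U p < 0 := by
  have hmin' : IsLocalMin (fun p => U (-p)) (-c) :=
    IsLocalMin.comp_continuous (f := U) (by rwa [neg_neg]) continuous_neg.continuousAt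
  obtain ⟨p, hp⟩ := exists_deriv_pos_of_isLocalMin (hdiff.fun_comp differentiable_neg)
    (by simpa [deriv_comp_neg] using hdense.preimage (Homeomorph.neg ℝ).isOpenMap) hmin'
  exact ⟨-p, by simpa [deriv_comp_neg] using hp⟩

theorem IsSkewPeriodicPotential.periodic_deriv (hU : IsSkewPeriodicPotential U) :
    Function.Periodic (deriv U) 1 := by
  obtain ⟨-, V, b, -, hper, hUV⟩ := hU
  intro p
  have h : (fun q => U (q + 1)) = fun q => U q - b := by
    funext q
    rw [hUV, hUV, hper q]
    ring
  rw [← deriv_comp_add_const, h, deriv_sub_const]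

namespace HasInterleavedCriticalPoints

variable {k : ℕ} {x z : ℤ → ℝ}

theorem setOf_deriv_eq_zero (hcrit : HasInterleavedCriticalPoints U k x z) :
    {p | deriv U p = 0} = range x ∪ range z := by
  ext p
  simp only [mem_ofPred_eq, hcrit.critical_iff, mem_union, mem_range, eq_comm]

theorem dense_setOf_deriv_ne_zero (hcrit : HasInterleavedCriticalPoints U k x z) :
    Dense {p | deriv U p ≠ 0} := by
  have hcount : {p | deriv U p = 0}.Countable :=
    hcrit.setOf_deriv_eq_zero ▸ (countable_range x).union (countable_range z)
  exact hcount.dense_compl ℝ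

theorem image_setOf_deriv_eq_zero (hcrit : HasInterleavedCriticalPoints U k x z) :
    (fun p : ℝ => (p : UnitAddCircle)) '' {p | deriv U p = 0} =
      {p : UnitAddCircle | (∃ i : ℤ, p = (x i : UnitAddCircle)) ∨
        ∃ i : ℤ, p = (z i : UnitAddCircle)} := by
  rw [hcrit.setOf_deriv_eq_zero, image_union, ← range_comp, ← range_comp]
  ext p
  simp only [mem_ofPred_eq, mem_union, mem_range, Function.comp_apply, eq_comm]

end HasInterleavedCriticalPoints

end CriticalPoints

theorem mainTheorem10_general {U : ℝ → ℝ} (hU : ContDiff ℝ 1 U)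
    (hper : Function.Periodic (deriv U) 1) :
    ((∃ p, 0 < deriv U p) → (∃ p, deriv U p < 0) →
      projectedAubrySet U = (fun p : ℝ => (p : UnitAddCircle)) '' {p | deriv U p = 0}) ∧
    (∀ w : UnitAddCircle → ℝ, IsWeakKAMSolution U w →
      (∀ t : ℝ, 0 ≤ t → ∀ y : UnitAddCircle,
        laxOleinik U t (fun q => (w q : EReal)) y = (w y : EReal)) ∧
      (∀ y : UnitAddCircle,
        (w y : EReal) = ⨅ q : UnitAddCircle, ((w q : EReal) + (manePotential U y q : EReal))) ∧
      (∀ y : UnitAddCircle,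
        (w y : EReal) =
          ⨅ q ∈ projectedAubrySet U, ((w q : EReal) + (peierlsBarrier U y q : EReal)))) ∧
    ∀ (k : ℕ) (x : ℤ → ℝ), 0 < k → (∀ i ∈ Icc (1 : ℤ) k, deriv U (x i) = 0) →
      (∀ y : UnitAddCircle, freidlinWentzell U k x y ≠ ⊤) ∧
      (∀ t : ℝ, 0 ≤ t → ∀ y : UnitAddCircle,
        laxOleinik U t (fun q => (freidlinWentzell U k x q : EReal)) y =
          (freidlinWentzell U k x y : EReal)) := by
  have hcont : Continuous (deriv U) := hU.continuous_deriv le_rfl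
  obtain ⟨M, hM⟩ : ∃ M, ∀ p, |deriv U p| ≤ M :=
    (isBounded_iff_forall_norm_le.1 (hper.isBounded_of_continuous one_ne_zero hcont)).imp
      fun M h p => h _ (mem_range_self p)
  refine ⟨projectedAubrySet_eq hper hcont hM, fun w hw => ⟨fun t => hw.laxOleinik_eq,
    hw.eq_iInf_manePotential, hw.eq_iInf_peierlsBarrier hper hM⟩, fun k x hk hx =>
    ⟨freidlinWentzell_ne_top hper hM hk (hx 1 ⟨le_rfl, by exact_mod_cast hk⟩),
      fun t => laxOleinik_freidlinWentzell hper hx⟩⟩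

theorem mainTheorem10 (U : ℝ → ℝ) (hU : IsSkewPeriodicPotential U)
    (k : ℕ) (x z : ℤ → ℝ) (hcrit : HasInterleavedCriticalPoints U k x z) :
    -- the projected Aubry set consists of the critical points of `U`
    projectedAubrySet U =
      {p : UnitAddCircle | (∃ i : ℤ, p = (x i : UnitAddCircle)) ∨
        ∃ i : ℤ, p = (z i : UnitAddCircle)} ∧
    -- every weak KAM solution is invariant, and has the two representations
    (∀ w : UnitAddCircle → ℝ, IsWeakKAMSolution U w →
      (∀ t : ℝ, 0 ≤ t → ∀ y : UnitAddCircle,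
        laxOleinik U t (fun q => (w q : EReal)) y = (w y : EReal)) ∧
      (∀ y : UnitAddCircle,
        (w y : EReal) = ⨅ q : UnitAddCircle, ((w q : EReal) + (manePotential U y q : EReal))) ∧
      (∀ y : UnitAddCircle,
        (w y : EReal) =
          ⨅ q ∈ projectedAubrySet U, ((w q : EReal) + (peierlsBarrier U y q : EReal)))) ∧
    -- the Freidlin–Wentzell function is finite and invariant
    (∀ y : UnitAddCircle, freidlinWentzell U k x y ≠ ⊤) ∧
    (∀ t : ℝ, 0 ≤ t → ∀ y : UnitAddCircle,
      laxOleinik U t (fun q => (freidlinWentzell U k x q : EReal)) y =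
        (freidlinWentzell U k x y : EReal)) := by
  have hC1 : ContDiff ℝ 1 U := hU.1.of_le (by exact_mod_cast le_top)
  obtain ⟨haubry, hweakKAM, hFW⟩ := mainTheorem10_general hC1 hU.periodic_deriv
  have hdiff : Differentiable ℝ U := hC1.differentiable one_ne_zero
  have hpos := exists_deriv_pos_of_isLocalMin hdiff hcrit.dense_setOf_deriv_ne_zero
    (hcrit.isLocalMin 0)
  have hneg := exists_deriv_neg_of_isLocalMin hdiff hcrit.dense_setOf_deriv_ne_zero
    (hcrit.isLocalMin 0)
  exact ⟨(haubry hpos hneg).trans hcrit.image_setOf_deriv_eq_zero, hweakKAM,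
    hFW k x hcrit.pos fun i _ => (hcrit.critical_iff _).2 (Or.inl ⟨i, rfl⟩)⟩
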